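/- Let $f:\mathbb{R}^n\to\mathbb{R}$, $g:\mathbb{R}^n\to\mathbb{R}^m$ and $h:\mathbb{R}^n\to\mathbb{R}^p$ be twice continuously differentiable, let $\rho>0$, and consider the sparse optimization problem $$\min_x\ f(x)+\rho\,\|x\|_0\quad\text{s.t.}\quad x\in X:=\{x\in\mathbb{R}^n \mid g(x)\le 0,\ h(x)=0\},\tag{SPO}$$ where $\|x\|_0$ is the number of nonzero components of $x$. Put $I_0(x):=\{i\mid x_i=0\}$, $I_g(x):=\{i\mid g_i(x)=0\}$ and $L^{SP}(x,\lambda,\mu):=f(x)+\lambda^Tg(x)+\mu^Th(x)$. A feasible point $x^*\in X$ satisfies SP-LICQ if the vectors $\nabla g_i(x^*)$ $(i\in I_g(x^*))$, $\nabla h_i(x^*)$ $(i=1,\dots,p)$, $e_i$ $(i\in I_0(x^*))$ are linearly independent. A triple $(x^*,\lambda^*,\mu^*)\in\mathbb{R}^n\times\mathbb{R}^m\times\mathbb{R}^p$ is S-stationary if $$\nabla_{x_i}L^{SP}(x^*,\lambda^*,\mu^*)=0\ \ (i\notin I_0(x^*)),\qquad \lambda^*\ge 0,\ g(x^*)\le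 0,\ \lambda^*\circ g(x^*)=0,\qquad h(x^*)=0,$$ where $\circ$ is the componentwise product. The sparse critical cone $C^{SPO}(x^*,\lambda^*)$ is the set of all $d\in\mathbb{R}^n$ such that $\nabla g_i(x^*)^Td=0$ for all $i\in I_g(x^*)$ with $\lambda_i^*>0$, $\nabla g_i(x^*)^Td\le 0$ for all $i\in I_g(x^*)$ with $\lambda_i^*=0$, $\nabla h_i(x^*)^Td=0$ for all $i=1,\dots,p$, and $d_i=0$ for all $i\in I_0(x^*)$. **Theorem (Second-Order Necessary Condition).** Let $x^*$ be a local minimum of (SPO) satisfying SP-LICQ. Then there exist unique multipliers $(\lambda^*,\mu^*)\in\mathbb{R}^m\times\mathbb{R}^p$ such that $(x^*,\lambda^*,\mu^*)$ is S-stationary. Moreover, these multipliers satisfy $$d^T\,\nabla^2_{xx}L^{SP}(x^*,\lambda^*,\mu^*)\,d\ \ge\ 0\qquad\text{for all } d\in C^{SPO}(x^*,\lambda^*).$$ -/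

import Mathlib

noncomputable section

/-- Data of the sparse optimization problem
`min f x + rho * ‖x‖₀` subject to `g x ≤ 0`, `h x = 0`, with `x ∈ ℝⁿ`,
`m` inequality constraints and `p` equality constraints. -/
structure SparseProblem (n m p : ℕ) where
  f : EuclideanSpace ℝ (Fin n) → ℝ
  g : EuclideanSpace ℝ (Fin n) → EuclideanSpace ℝ (Fin m)
  h : EuclideanSpace ℝ (Fin n) → EuclideanSpace ℝ (Fin p)
  rho : ℝ

namespace SparseProblem

/-- The feasible set `X = {x | g x ≤ 0, h x = 0}`. -/
def feasibleSet {n m p : ℕ} (P : SparseProblem n m p) : Set (EuclideanSpace ℝ (Fin n)) :=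
  {x | (∀ i, P.g x i ≤ 0) ∧ ∀ j, P.h x j = 0}

/-- The objective `f x + rho * ‖x‖₀`, where `‖x‖₀` is the number of nonzero components of `x`. -/
def objective {n m p : ℕ} (P : SparseProblem n m p) (x : EuclideanSpace ℝ (Fin n)) : ℝ :=
  P.f x + P.rho * (hammingNorm (fun i => x i) : ℝ)

/-- `x` is feasible and minimizes the objective among the feasible points near `x`. -/
def IsLocalMinimum {n m p : ℕ} (P : SparseProblem n m p) (x : EuclideanSpace ℝ (Fin n)) : Prop :=
  x ∈ P.feasibleSet ∧ IsLocalMinOn P.objective P.feasibleSet x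

/-- The index set `I₀(x)` of zero components. -/
def zeroIndices {n : ℕ} (x : EuclideanSpace ℝ (Fin n)) : Set (Fin n) :=
  {i | x i = 0}

/-- The index set `I_g(x)` of active inequality constraints. -/
def activeIndices {n m p : ℕ} (P : SparseProblem n m p) (x : EuclideanSpace ℝ (Fin n)) :
    Set (Fin m) :=
  {i | P.g x i = 0}

/-- The gradient `∇ gᵢ(x)`. -/
def gradG {n m p : ℕ} (P : SparseProblem n m p) (x : EuclideanSpace ℝ (Fin n)) (i : Fin m) :
    EuclideanSpace ℝ (Fin n) :=
  gradient (fun z => P.g z i) x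

/-- The gradient `∇ hⱼ(x)`. -/
def gradH {n m p : ℕ} (P : SparseProblem n m p) (x : EuclideanSpace ℝ (Fin n)) (j : Fin p) :
    EuclideanSpace ℝ (Fin n) :=
  gradient (fun z => P.h z j) x

/-- Sparse LICQ: `x` is feasible, and the vectors `∇ gᵢ(x)` (`i` active), `∇ hⱼ(x)` (all `j`)
and `eₖ` (`xₖ = 0`) form a linearly independent family. -/
def SPLICQ {n m p : ℕ} (P : SparseProblem n m p) (x : EuclideanSpace ℝ (Fin n)) : Prop :=
  x ∈ P.feasibleSet ∧
    LinearIndependent ℝ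
      (Sum.elim (fun i : P.activeIndices x => P.gradG x i)
        (Sum.elim (fun j : Fin p => P.gradH x j)
          (fun k : zeroIndices x => EuclideanSpace.single (k : Fin n) (1 : ℝ))))

/-- The function `L^SP(x, lam, mu) = f x + lamᵀ g x + muᵀ h x`. -/
def lagrangian {n m p : ℕ} (P : SparseProblem n m p) (x : EuclideanSpace ℝ (Fin n))
    (lam : EuclideanSpace ℝ (Fin m)) (mu : EuclideanSpace ℝ (Fin p)) : ℝ :=
  P.f x + ∑ i, lam i * P.g x i + ∑ j, mu j * P.h x j

/-- The gradient of `L^SP` in its first argument. -/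
def gradLagrangian {n m p : ℕ} (P : SparseProblem n m p) (x : EuclideanSpace ℝ (Fin n))
    (lam : EuclideanSpace ℝ (Fin m)) (mu : EuclideanSpace ℝ (Fin p)) :
    EuclideanSpace ℝ (Fin n) :=
  gradient (fun z => P.lagrangian z lam mu) x

/-- The Hessian of `L^SP` in its first argument, as the derivative of the gradient. -/
def hessLagrangian {n m p : ℕ} (P : SparseProblem n m p) (x : EuclideanSpace ℝ (Fin n))
    (lam : EuclideanSpace ℝ (Fin m)) (mu : EuclideanSpace ℝ (Fin p)) :
    EuclideanSpace ℝ (Fin n) →L[ℝ] EuclideanSpace ℝ (Fin n) :=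
  fderiv ℝ (fun z => P.gradLagrangian z lam mu) x

/-- `(x, lam, mu)` is S-stationary. -/
structure IsSStationary {n m p : ℕ} (P : SparseProblem n m p) (x : EuclideanSpace ℝ (Fin n))
    (lam : EuclideanSpace ℝ (Fin m)) (mu : EuclideanSpace ℝ (Fin p)) : Prop where
  grad_eq_zero : ∀ i, i ∉ zeroIndices x → P.gradLagrangian x lam mu i = 0
  lam_nonneg : ∀ i, 0 ≤ lam i
  g_nonpos : ∀ i, P.g x i ≤ 0
  complementarity : ∀ i, lam i * P.g x i = 0
  h_eq_zero : ∀ j, P.h x j = 0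

/-- The sparse critical cone `C^SPO(x, lam)`. -/
def criticalCone {n m p : ℕ} (P : SparseProblem n m p) (x : EuclideanSpace ℝ (Fin n))
    (lam : EuclideanSpace ℝ (Fin m)) : Set (EuclideanSpace ℝ (Fin n)) :=
  {d | (∀ i ∈ P.activeIndices x, 0 < lam i → inner ℝ (P.gradG x i) d = 0) ∧
    (∀ i ∈ P.activeIndices x, lam i = 0 → inner ℝ (P.gradG x i) d ≤ 0) ∧
    (∀ j, inner ℝ (P.gradH x j) d = 0) ∧
    ∀ k ∈ zeroIndices x, d k = 0}

end SparseProblem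

end

/-! Since `rho` is positive, moving while keeping the zero coordinates of `x` at zero cannot
increase the penalty. So `x` locally minimizes `f` under the extra constraints `z k = 0` on `I₀(x)`,
a smooth program whose LICQ is SP-LICQ. Independence makes each direction tangent to a curve along
which these constraints and the active ones are exactly affine in `t`
(`exists_curve_of_linearIndependent`), hence feasible for small `t > 0` when the direction is
linearized feasible. Slopes of `f` along such curves yield the multipliers. For a critical direction
the Lagrangian equals `f` on the curve and its first-order term vanishes, so a Taylor expansion
leaves the Hessian inequality. -/

open Filter Topology Asymptotics

/-! ### Curves with prescribed constraint values, and second-order expansion. -/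

section General

variable {E : Type*} [NormedAddCommGroup E] [InnerProductSpace ℝ E]

theorem LinearIndependent.exists_inner_eq [FiniteDimensional ℝ E] {ι : Type*} {a : ι → E}
    (ha : LinearIndependent ℝ a) (v : ι → ℝ) : ∃ d : E, ∀ i, inner ℝ (a i) d = v i := by
  obtain ⟨l, hl⟩ := (((Module.Basis.span ha).constr ℝ) v).exists_extend
  refine ⟨(InnerProductSpace.toDual ℝ E).symm (LinearMap.toContinuousLinearMap l), fun i => ?_⟩
  rw [real_inner_comm, InnerProductSpace.toDual_symm_apply]
  have h := LinearMap.congr_fun hl (Module.Basis.span ha i)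
  rw [Module.Basis.constr_basis] at h
  simpa [Module.Basis.span_apply] using h

/-- The map `Φ` below has derivative the identity at `x`, and `F' (Φ z - x) = F z - F x` because `R`
is a right inverse of `F'`. Pulling the line `x + t • d` back through `Φ` therefore makes `F`
affine. -/
theorem HasStrictFDerivAt.exists_curve [CompleteSpace E] {V : Type*} [NormedAddCommGroup V]
    [NormedSpace ℝ V] {F : E → V} {F' : E →L[ℝ] V} {x : E} (hF : HasStrictFDerivAt F F' x)
    (R : V →L[ℝ] E) (hR : ∀ v, F' (R v) = v) (d : E) :
    ∃ z : ℝ → E, z 0 = x ∧ HasDerivAt z d 0 ∧ ∀ᶠ t in 𝓝 (0 : ℝ), F (z t) = F x + t • F' d := by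
  set Φ : E → E := fun z => z + R (F z - F x - F' (z - x)) with hΦdef
  have hΦx : Φ x = x := by simp [hΦdef]
  have hΦ : HasStrictFDerivAt Φ ((ContinuousLinearEquiv.refl ℝ E : E ≃L[ℝ] E) : E →L[ℝ] E) x := by
    have h1 := (hF.sub_const (F x)).sub
      (F'.hasStrictFDerivAt.comp x ((hasStrictFDerivAt_id x).sub_const x))
    have h2 := (hasStrictFDerivAt_id x).add (R.hasStrictFDerivAt.comp x h1)
    refine h2.congr_fderiv ?_
    ext w
    simp
  have hs := hΦ.to_localInverse
  have hr := hΦ.eventually_right_inverse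
  have hi := hΦ.localInverse_apply_image
  rw [hΦx] at hs hr hi
  have hl : HasDerivAt (fun t : ℝ => x + t • d) d 0 := by
    simpa using ((hasDerivAt_id (0 : ℝ)).smul_const d).const_add x
  have hl0 : x + (0 : ℝ) • d = x := by simp
  refine ⟨fun t => hΦ.localInverse Φ _ x (x + t • d), by simpa using hi, ?_, ?_⟩
  · have := (show HasFDerivAt _ _ (x + (0 : ℝ) • d) by
      rw [hl0]; exact hs.hasFDerivAt).comp_hasDerivAt (0 : ℝ) hl
    simpa [Function.comp_def] using this
  · have hc : Tendsto (fun t : ℝ => x + t • d) (𝓝 0) (𝓝 x) := by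
      simpa using hl.continuousAt.tendsto
    filter_upwards [hc.eventually hr] with t ht
    generalize hΦ.localInverse Φ _ x (x + t • d) = y at ht ⊢
    have h2 := congrArg (fun w => F' (w - x)) ht
    simp only [hΦdef, map_sub, map_add, hR, map_smul] at h2
    have h3 : F y - F x = t • F' d := by
      rw [← add_sub_cancel_left (F' x) (t • F' d), ← h2]
      abel
    rw [← h3]
    abel

theorem exists_curve_of_linearIndependent [FiniteDimensional ℝ E] {ι : Type*} [Fintype ι]
    {c : ι → E → ℝ} {a : ι → E} {x : E}
    (hc : ∀ i, HasStrictFDerivAt (c i) (innerSL ℝ (a i)) x) (ha : LinearIndependent ℝ a) (d : E) :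
    ∃ z : ℝ → E, z 0 = x ∧ HasDerivAt z d 0 ∧
      ∀ᶠ t in 𝓝 (0 : ℝ), ∀ i, c i (z t) = c i x + t * inner ℝ (a i) d := by
  have := FiniteDimensional.complete ℝ E
  have hF : HasStrictFDerivAt (fun z i => c i z) (ContinuousLinearMap.pi fun i => innerSL ℝ (a i))
      x := hasStrictFDerivAt_pi.2 hc
  have hsurj : LinearMap.range
      ((ContinuousLinearMap.pi fun i => innerSL ℝ (a i) : E →L[ℝ] ι → ℝ) : E →ₗ[ℝ] ι → ℝ) = ⊤ := by
    rw [LinearMap.range_eq_top]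
    intro v
    obtain ⟨w, hw⟩ := ha.exists_inner_eq v
    exact ⟨w, funext fun i => by simpa using hw i⟩
  obtain ⟨R, hR⟩ := LinearMap.exists_rightInverse_of_surjective _ hsurj
  obtain ⟨z, h0, hd, hz⟩ := hF.exists_curve (LinearMap.toContinuousLinearMap R)
    (fun v => LinearMap.congr_fun hR v) d
  refine ⟨z, h0, hd, hz.mono fun t ht i => ?_⟩
  simpa using congrFun ht i

theorem mem_span_range_of_forall_inner_eq_zero {ι : Type*} [Finite ι] {a : ι → E}
    {v : E} (h : ∀ d, (∀ i, inner ℝ (a i) d = 0) → inner ℝ v d = 0) :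
    v ∈ Submodule.span ℝ (Set.range a) := by
  have : FiniteDimensional ℝ (Submodule.span ℝ (Set.range a)) :=
    FiniteDimensional.span_of_finite ℝ (Set.finite_range a)
  rw [← Submodule.orthogonal_orthogonal (Submodule.span ℝ (Set.range a)),
    Submodule.mem_orthogonal']
  intro d hd
  refine h d fun i => ?_
  exact (Submodule.mem_orthogonal _ _).1 hd _ (Submodule.subset_span ⟨i, rfl⟩)

theorem taylor_two_isLittleO [CompleteSpace E] {L : E → ℝ} {G : E → E} {H : E →L[ℝ] E} {x : E}
    (hL : ∀ z, HasGradientAt L (G z) z) (hG : HasFDerivAt G H x) :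
    (fun z => L z - L x - inner ℝ (G x) (z - x) - inner ℝ (H (z - x)) (z - x) / 2)
      =o[𝓝 x] fun z => ‖z - x‖ ^ 2 := by
  rw [isLittleO_iff]
  intro ε hε
  have h1 := (hasFDerivAt_iff_isLittleO.1 hG).def hε
  obtain ⟨r, hr, hb⟩ := Metric.eventually_nhds_iff.1 h1
  refine Metric.eventually_nhds_iff.2 ⟨r, hr, fun z hz => ?_⟩
  set w := z - x with hw
  -- Subtracting the quadratic model along the segment leaves the first-order remainder of `G` as
  -- derivative. The mean value inequality then applies, and `H` need not be known symmetric.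
  have hderiv : ∀ s : ℝ, HasDerivAt
      (fun s : ℝ => L (x + s • w) - s * inner ℝ (G x) w - s ^ 2 * (inner ℝ (H w) w / 2))
      (inner ℝ (G (x + s • w) - G x - H (s • w)) w) s := by
    intro s
    have hl : HasDerivAt (fun s : ℝ => x + s • w) w s := by
      simpa using ((hasDerivAt_id s).smul_const w).const_add x
    have h2 := (hL (x + s • w)).hasFDerivAt.comp_hasDerivAt s hl
    have h3 := (h2.sub ((hasDerivAt_id s).mul_const (inner ℝ (G x) w))).sub
      (((hasDerivAt_id s).pow 2).mul_const (inner ℝ (H w) w / 2))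
    refine h3.congr_deriv ?_
    simp [inner_sub_left, inner_smul_left]
    ring
  have hbound : ∀ s ∈ Set.Ico (0 : ℝ) 1,
      ‖inner ℝ (G (x + s • w) - G x - H (s • w)) w‖ ≤ ε * ‖w‖ ^ 2 := by
    intro s hs
    have hsw : ‖s • w‖ ≤ ‖w‖ := by
      rw [norm_smul, Real.norm_of_nonneg hs.1]
      exact mul_le_of_le_one_left (norm_nonneg _) hs.2.le
    have h4 := @hb (x + s • w) (by
      rw [dist_eq_norm, add_sub_cancel_left]
      rw [dist_eq_norm] at hz
      exact hsw.trans_lt hz)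
    rw [add_sub_cancel_left] at h4
    calc _ ≤ ‖G (x + s • w) - G x - H (s • w)‖ * ‖w‖ := norm_inner_le_norm _ _
      _ ≤ ε * ‖w‖ * ‖w‖ := by gcongr; exact h4.trans (by gcongr)
      _ = ε * ‖w‖ ^ 2 := by ring
  have h5 := norm_image_sub_le_of_norm_deriv_le_segment_01'
    (fun s _ => (hderiv s).hasDerivWithinAt) hbound
  have hxw : x + w = z := by simp [hw]
  simp only [one_smul, hxw, zero_smul, add_zero] at h5
  rw [norm_pow, norm_norm]
  refine le_of_eq_of_le (congrArg norm ?_) h5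
  clear_value w
  ring

/-- The linear term is taken at `z t - x` rather than `t • d`, so no second derivative of the curve
enters. Dividing the expansion by `t ^ 2` gives the limit. -/
theorem inner_hessian_nonneg_of_curve [CompleteSpace E] {L : E → ℝ} {G : E → E} {H : E →L[ℝ] E}
    {x d : E} (hL : ∀ z, HasGradientAt L (G z) z) (hG : HasFDerivAt G H x) {z : ℝ → E}
    (hz0 : z 0 = x) (hz : HasDerivAt z d 0)
    (hmin : ∀ᶠ t in 𝓝[>] (0 : ℝ), L x + inner ℝ (G x) (z t - x) ≤ L (z t)) :
    0 ≤ inner ℝ d (H d) := by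
  have hzx : Tendsto z (𝓝[>] 0) (𝓝 x) := by
    rw [← hz0]; exact hz.continuousAt.tendsto.mono_left nhdsWithin_le_nhds
  have hslope : Tendsto (fun t : ℝ => t⁻¹ • (z t - x)) (𝓝[>] 0) (𝓝 d) := by
    have := hz.tendsto_slope_zero_right
    simpa [hz0] using this
  have hO : (fun t => ‖z t - x‖ ^ 2) =O[𝓝[>] (0 : ℝ)] fun t => t ^ 2 := by
    have : (fun t => z t - x) =O[𝓝[>] (0 : ℝ)] fun t => t := by
      have := hz.isBigO_sub.mono (nhdsWithin_le_nhds (s := Set.Ioi 0))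
      simpa [hz0] using this
    exact this.norm_left.pow 2
  have ho := ((taylor_two_isLittleO hL hG).comp_tendsto hzx).trans_isBigO hO
  have hlim := ho.tendsto_div_nhds_zero
  have hq : Tendsto (fun t : ℝ => inner ℝ (H (t⁻¹ • (z t - x))) (t⁻¹ • (z t - x)) / 2)
      (𝓝[>] 0) (𝓝 (inner ℝ (H d) d / 2)) :=
    (((H.continuous.tendsto d).comp hslope).inner hslope).div_const 2
  have hsum := hlim.add hq
  have : 0 ≤ 0 + inner ℝ (H d) d / 2 := by
    refine ge_of_tendsto hsum ?_
    filter_upwards [hmin, self_mem_nhdsWithin] with t ht htpos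
    have htpos : 0 < t := htpos
    have : inner ℝ (H (t⁻¹ • (z t - x))) (t⁻¹ • (z t - x)) / 2
        = inner ℝ (H (z t - x)) (z t - x) / 2 / t ^ 2 := by
      rw [map_smul, real_inner_smul_left, real_inner_smul_right]
      field_simp
    simp only [Function.comp_apply]
    rw [this, ← add_div]
    apply div_nonneg _ (by positivity)
    linarith
  rw [real_inner_comm]
  linarith

theorem ContDiff.hasGradientAt_gradient [CompleteSpace E] {f : E → ℝ} (hf : ContDiff ℝ 2 f)
    (z : E) : HasGradientAt f (gradient f z) z :=
  (hf.differentiable (by norm_num) z).hasGradientAt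

theorem ContDiff.differentiable_gradient [CompleteSpace E] {f : E → ℝ} (hf : ContDiff ℝ 2 f) :
    Differentiable ℝ (gradient f) := by
  have : Differentiable ℝ (fderiv ℝ f) :=
    (hf.fderiv_right (m := 1) (by norm_num)).differentiable (by norm_num)
  exact (InnerProductSpace.toDual ℝ E).symm.toContinuousLinearEquiv.differentiable.comp this

end General

theorem ContDiff.hasStrictFDerivAt_innerSL_gradient {E : Type*} [NormedAddCommGroup E]
    [InnerProductSpace ℝ E] [CompleteSpace E] {f : E → ℝ} (hf : ContDiff ℝ 2 f) (x : E) :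
    HasStrictFDerivAt f (innerSL ℝ (gradient f x)) x := by
  refine (hf.contDiffAt.hasStrictFDerivAt (by norm_num)).congr_fderiv ?_
  exact (hf.hasGradientAt_gradient x).hasFDerivAt.fderiv

/-! ### First-order analysis of the sparse problem. -/

namespace SparseProblem

variable {n m p : ℕ} {P : SparseProblem n m p} {x : EuclideanSpace ℝ (Fin n)}

theorem contDiff_g_apply (hg : ContDiff ℝ 2 P.g) (i : Fin m) : ContDiff ℝ 2 fun z => P.g z i :=
  (contDiff_euclidean.1 hg) i

theorem contDiff_h_apply (hh : ContDiff ℝ 2 P.h) (j : Fin p) : ContDiff ℝ 2 fun z => P.h z j :=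
  (contDiff_euclidean.1 hh) j

theorem contDiff_lagrangian (hf : ContDiff ℝ 2 P.f) (hg : ContDiff ℝ 2 P.g)
    (hh : ContDiff ℝ 2 P.h) (lam : EuclideanSpace ℝ (Fin m)) (mu : EuclideanSpace ℝ (Fin p)) :
    ContDiff ℝ 2 fun z => P.lagrangian z lam mu :=
  (hf.add (ContDiff.sum fun i _ => contDiff_const.mul (contDiff_g_apply hg i))).add
    (ContDiff.sum fun j _ => contDiff_const.mul (contDiff_h_apply hh j))

theorem gradLagrangian_eq (hf : ContDiff ℝ 2 P.f) (hg : ContDiff ℝ 2 P.g)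
    (hh : ContDiff ℝ 2 P.h) (x : EuclideanSpace ℝ (Fin n))
    (lam : EuclideanSpace ℝ (Fin m)) (mu : EuclideanSpace ℝ (Fin p)) :
    P.gradLagrangian x lam mu =
      gradient P.f x + ∑ i, lam i • P.gradG x i + ∑ j, mu j • P.gradH x j := by
  refine HasGradientAt.gradient (hasGradientAt_iff_hasFDerivAt.2 ?_)
  simp only [map_add, map_sum, map_smul]
  refine ((hf.hasGradientAt_gradient x).hasFDerivAt.add
    (HasFDerivAt.fun_sum fun i _ => ?_)).add (HasFDerivAt.fun_sum fun j _ => ?_)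
  · exact ((contDiff_g_apply hg i).hasGradientAt_gradient x).hasFDerivAt.const_mul (lam i)
  · exact ((contDiff_h_apply hh j).hasGradientAt_gradient x).hasFDerivAt.const_mul (mu j)

theorem hammingNorm_le_of_zeroIndices {z : EuclideanSpace ℝ (Fin n)}
    (hz : ∀ k ∈ zeroIndices x, z k = 0) :
    hammingNorm (fun i => z i) ≤ hammingNorm (fun i => x i) := by
  refine Finset.card_le_card fun i hi => ?_
  simp only [Finset.mem_filter, Finset.mem_univ, true_and] at hi ⊢
  exact fun h => hi (hz i h)

/-- Near a local minimum, feasible points vanishing on `I₀(x)` do not decrease `f`. -/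
theorem IsLocalMinimum.eventually_le (hmin : P.IsLocalMinimum x) (hrho : 0 < P.rho) :
    ∀ᶠ z in 𝓝 x, z ∈ P.feasibleSet → (∀ k ∈ zeroIndices x, z k = 0) → P.f x ≤ P.f z := by
  filter_upwards [eventually_nhdsWithin_iff.1 hmin.2] with z hz hfeas hzero
  have h1 := hz hfeas
  have h2 : (hammingNorm (fun i => z i) : ℝ) ≤ hammingNorm (fun i => x i) := by
    exact_mod_cast hammingNorm_le_of_zeroIndices hzero
  have h3 := mul_le_mul_of_nonneg_left h2 hrho.le
  simp only [objective] at h1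
  linarith

theorem exists_feasible_curve (hrho : 0 < P.rho) (hg : ContDiff ℝ 2 P.g) (hh : ContDiff ℝ 2 P.h)
    (hmin : P.IsLocalMinimum x) (hlicq : P.SPLICQ x) {d : EuclideanSpace ℝ (Fin n)}
    (hdg : ∀ i ∈ P.activeIndices x, inner ℝ (P.gradG x i) d ≤ 0)
    (hdh : ∀ j, inner ℝ (P.gradH x j) d = 0) (hdz : ∀ k ∈ zeroIndices x, d k = 0) :
    ∃ z : ℝ → EuclideanSpace ℝ (Fin n), z 0 = x ∧ HasDerivAt z d 0 ∧
      ∀ᶠ t in 𝓝[>] (0 : ℝ), P.f x ≤ P.f (z t) ∧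
        (∀ i ∈ P.activeIndices x, P.g (z t) i = t * inner ℝ (P.gradG x i) d) ∧
        (∀ j, P.h (z t) j = 0) ∧ ∀ k ∈ zeroIndices x, z t k = 0 := by
  classical
  have : Fintype (P.activeIndices x) := Fintype.ofFinite _
  have : Fintype (zeroIndices x) := Fintype.ofFinite _
  obtain ⟨z, hz0, hzd, hz⟩ := exists_curve_of_linearIndependent (x := x)
    (c := Sum.elim (fun (i : P.activeIndices x) y => P.g y i)
      (Sum.elim (fun j y => P.h y j) (fun (k : zeroIndices x) y => y k))) (by
    rintro (i | j | k)
    · exact (contDiff_g_apply hg i).hasStrictFDerivAt_innerSL_gradient x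
    · exact (contDiff_h_apply hh j).hasStrictFDerivAt_innerSL_gradient x
    · refine (EuclideanSpace.proj (k : Fin n) : _ →L[ℝ] ℝ).hasStrictFDerivAt.congr_fderiv ?_
      ext w
      simp [EuclideanSpace.inner_single_left]) hlicq.2 d
  refine ⟨z, hz0, hzd, ?_⟩
  have hzx : Tendsto z (𝓝[>] 0) (𝓝 x) := by
    rw [← hz0]; exact hzd.continuousAt.tendsto.mono_left nhdsWithin_le_nhds
  -- Inactive constraints stay strict by continuity, so the curve need only control the active ones.
  have hinact : ∀ᶠ y in 𝓝 x, ∀ i ∉ P.activeIndices x, P.g y i < 0 := by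
    refine eventually_all.2 fun i => ?_
    by_cases hi : i ∈ P.activeIndices x
    · simp [hi]
    · filter_upwards [(contDiff_g_apply hg i).continuous.continuousAt.eventually_lt_const
        (lt_of_le_of_ne (hmin.1.1 i) hi)] with y hy _ using hy
  filter_upwards [hz.filter_mono nhdsWithin_le_nhds, hzx.eventually hinact,
    hzx.eventually (hmin.eventually_le hrho), self_mem_nhdsWithin] with t ht hin hle htpos
  have hG : ∀ i ∈ P.activeIndices x, P.g (z t) i = t * inner ℝ (P.gradG x i) d := by
    intro i hi
    have h1 := ht (Sum.inl ⟨i, hi⟩)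
    have h2 : P.g x i = 0 := hi
    simpa [h2] using h1
  have hH : ∀ j, P.h (z t) j = 0 := by
    intro j
    have h1 := ht (Sum.inr (Sum.inl j))
    simpa [hmin.1.2 j, hdh j] using h1
  have hZ : ∀ k ∈ zeroIndices x, z t k = 0 := by
    intro k hk
    have h1 := ht (Sum.inr (Sum.inr ⟨k, hk⟩))
    have h2 : x k = 0 := hk
    simpa [EuclideanSpace.inner_single_left, h2, hdz k hk] using h1
  refine ⟨hle ⟨fun i => ?_, hH⟩ hZ, hG, hH, hZ⟩
  by_cases hi : i ∈ P.activeIndices x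
  · rw [hG i hi]
    exact mul_nonpos_of_nonneg_of_nonpos (le_of_lt htpos) (hdg i hi)
  · exact (hin i hi).le

theorem inner_gradient_nonneg (hrho : 0 < P.rho) (hf : ContDiff ℝ 2 P.f)
    (hg : ContDiff ℝ 2 P.g) (hh : ContDiff ℝ 2 P.h)
    (hmin : P.IsLocalMinimum x) (hlicq : P.SPLICQ x) {d : EuclideanSpace ℝ (Fin n)}
    (hdg : ∀ i ∈ P.activeIndices x, inner ℝ (P.gradG x i) d ≤ 0)
    (hdh : ∀ j, inner ℝ (P.gradH x j) d = 0) (hdz : ∀ k ∈ zeroIndices x, d k = 0) :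
    0 ≤ inner ℝ (gradient P.f x) d := by
  obtain ⟨z, hz0, hzd, hz⟩ := exists_feasible_curve hrho hg hh hmin hlicq hdg hdh hdz
  have h1 : HasDerivAt (P.f ∘ z) (inner ℝ (gradient P.f x) d) 0 := by
    have h2 := (hf.hasGradientAt_gradient (z 0)).hasFDerivAt.comp_hasDerivAt 0 hzd
    rw [hz0] at h2
    simpa using h2
  refine ge_of_tendsto h1.tendsto_slope_zero_right ?_
  filter_upwards [hz, self_mem_nhdsWithin] with t ht htpos
  simp only [zero_add, Function.comp_apply, hz0, smul_eq_mul]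
  exact mul_nonneg (inv_nonneg.2 (le_of_lt htpos)) (sub_nonneg.2 ht.1)

/-! ### Existence and uniqueness of multipliers. -/

theorem sum_eq_sum_activeIndices [Fintype (P.activeIndices x)] {M : Type*} [AddCommMonoid M]
    (u : Fin m → M) (hu : ∀ i ∉ P.activeIndices x, u i = 0) :
    ∑ i, u i = ∑ i : P.activeIndices x, u i := by
  classical
  rw [← Finset.sum_subset (Finset.subset_univ (P.activeIndices x).toFinset)
    (fun i _ hi => hu i (by simpa using hi))]
  exact (Finset.sum_subtype _ (by simp) _)

theorem IsSStationary.lam_eq_zero {lam : EuclideanSpace ℝ (Fin m)}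
    {mu : EuclideanSpace ℝ (Fin p)} (h : P.IsSStationary x lam mu) {i : Fin m}
    (hi : i ∉ P.activeIndices x) : lam i = 0 :=
  (mul_eq_zero.1 (h.complementarity i)).resolve_right hi

theorem exists_isSStationary (hrho : 0 < P.rho) (hf : ContDiff ℝ 2 P.f)
    (hg : ContDiff ℝ 2 P.g) (hh : ContDiff ℝ 2 P.h)
    (hmin : P.IsLocalMinimum x) (hlicq : P.SPLICQ x) :
    ∃ (lam : EuclideanSpace ℝ (Fin m)) (mu : EuclideanSpace ℝ (Fin p)),
      P.IsSStationary x lam mu := by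
  classical
  have : Fintype (P.activeIndices x) := Fintype.ofFinite _
  have : Fintype (zeroIndices x) := Fintype.ofFinite _
  have hspan := mem_span_range_of_forall_inner_eq_zero (v := gradient P.f x)
    (a := Sum.elim (fun i : P.activeIndices x => P.gradG x i)
        (Sum.elim (fun j : Fin p => P.gradH x j)
          (fun k : zeroIndices x => EuclideanSpace.single (k : Fin n) (1 : ℝ)))) (by
    -- On directions orthogonal to the whole family the slope inequality holds for both `d` and
    -- `-d`.
    intro d hd
    have hG : ∀ i ∈ P.activeIndices x, inner ℝ (P.gradG x i) d = 0 :=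
      fun i hi => hd (Sum.inl ⟨i, hi⟩)
    have hH : ∀ j, inner ℝ (P.gradH x j) d = 0 := fun j => hd (Sum.inr (Sum.inl j))
    have hZ : ∀ k ∈ zeroIndices x, d k = 0 := fun k hk => by
      simpa [EuclideanSpace.inner_single_left] using hd (Sum.inr (Sum.inr ⟨k, hk⟩))
    have h1 := inner_gradient_nonneg hrho hf hg hh hmin hlicq (fun i hi => (hG i hi).le) hH hZ
    have h2 := inner_gradient_nonneg hrho hf hg hh hmin hlicq (d := -d)
      (fun i hi => by simp [hG i hi]) (fun j => by simp [hH j]) (fun k hk => by simp [hZ k hk])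
    rw [inner_neg_right] at h2
    linarith)
  obtain ⟨c, hc⟩ := (Submodule.mem_span_range_iff_exists_fun ℝ).1 hspan
  -- The coefficients on the `eₖ` are dropped: stationarity is only required off `I₀(x)`.
  let lam : EuclideanSpace ℝ (Fin m) := WithLp.toLp 2 fun i =>
    if hi : i ∈ P.activeIndices x then -c (Sum.inl ⟨i, hi⟩) else 0
  let mu : EuclideanSpace ℝ (Fin p) := WithLp.toLp 2 fun j => -c (Sum.inr (Sum.inl j))
  have hlam : ∀ i (hi : i ∈ P.activeIndices x), lam i = -c (Sum.inl ⟨i, hi⟩) :=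
    fun i hi => dif_pos hi
  have hlam0 : ∀ i ∉ P.activeIndices x, lam i = 0 := fun i hi => dif_neg hi
  refine ⟨lam, mu, ?_, ?_, hmin.1.1, ?_, hmin.1.2⟩
  · intro i hi
    rw [gradLagrangian_eq hf hg hh, ← hc, sum_eq_sum_activeIndices (P := P) (x := x)
      (fun i => lam i • P.gradG x i) (fun i hi => by simp [hlam0 i hi])]
    have hz : ∑ k : zeroIndices x, c (Sum.inr (Sum.inr k)) *
        (EuclideanSpace.single (k : Fin n) (1 : ℝ)) i = 0 := by
      refine Finset.sum_eq_zero fun k _ => ?_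
      have : i ≠ k := fun h => hi (h ▸ k.2)
      simp [this]
    simp only [Fintype.sum_sum_type, Sum.elim_inl, Sum.elim_inr, PiLp.add_apply,
      WithLp.ofLp_sum, Finset.sum_apply, PiLp.smul_apply, smul_eq_mul, hz,
      fun k : P.activeIndices x => hlam k k.2]
    simp [mu]
  · intro i
    by_cases hi : i ∈ P.activeIndices x
    -- This direction isolates one constraint: the slope of `f` along it is exactly `lam i`, so
    -- Farkas' lemma is not needed.
    · obtain ⟨d, hd⟩ := hlicq.2.exists_inner_eq (Pi.single (Sum.inl ⟨i, hi⟩) (-1))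
      have h1 := inner_gradient_nonneg hrho hf hg hh hmin hlicq (d := d)
        (fun k hk => by
          have := hd (Sum.inl ⟨k, hk⟩)
          simp only [Sum.elim_inl] at this
          rw [this, Pi.single_apply]
          split_ifs <;> norm_num)
        (fun j => by simpa using hd (Sum.inr (Sum.inl j)))
        (fun k hk => by simpa [EuclideanSpace.inner_single_left] using hd (Sum.inr (Sum.inr ⟨k, hk⟩)))
      rw [← hc, sum_inner] at h1
      simp only [real_inner_smul_left, hd] at h1
      rw [Fintype.sum_eq_single (Sum.inl ⟨i, hi⟩)
        (fun k hk => by rw [Pi.single_eq_of_ne hk, mul_zero]), Pi.single_eq_same] at h1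
      rw [hlam i hi]
      simpa using h1
    · rw [hlam0 i hi]
  · intro i
    by_cases hi : i ∈ P.activeIndices x
    · rw [show P.g x i = 0 from hi, mul_zero]
    · rw [hlam0 i hi, zero_mul]

/-- The difference of the two Lagrangian gradients is supported on `I₀(x)`, so it is a combination
of the `eₖ` as well as of the constraint gradients. Independence kills all coefficients. -/
theorem IsSStationary.unique (hf : ContDiff ℝ 2 P.f) (hg : ContDiff ℝ 2 P.g)
    (hh : ContDiff ℝ 2 P.h) (hlicq : P.SPLICQ x) {lam lam' : EuclideanSpace ℝ (Fin m)}
    {mu mu' : EuclideanSpace ℝ (Fin p)} (h : P.IsSStationary x lam mu)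
    (h' : P.IsSStationary x lam' mu') : lam' = lam ∧ mu' = mu := by
  classical
  have : Fintype (P.activeIndices x) := Fintype.ofFinite _
  have : Fintype (zeroIndices x) := Fintype.ofFinite _
  set w := P.gradLagrangian x lam' mu' - P.gradLagrangian x lam mu with hw
  have hwz : w = ∑ k : zeroIndices x, w k • EuclideanSpace.single (k : Fin n) (1 : ℝ) := by
    ext i
    simp only [WithLp.ofLp_sum, Finset.sum_apply, PiLp.smul_apply, smul_eq_mul]
    by_cases hi : i ∈ zeroIndices x
    · rw [Finset.sum_eq_single ⟨i, hi⟩]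
      · simp
      · intro k _ hk
        have : i ≠ k := fun h => hk (Subtype.ext h.symm)
        simp [this]
      · simp
    · rw [Finset.sum_eq_zero]
      · simp [hw, h.grad_eq_zero i hi, h'.grad_eq_zero i hi]
      · intro k _
        have : i ≠ k := fun h => hi (h ▸ k.2)
        simp [this]
  have hwe : w = ∑ i : P.activeIndices x, (lam' i - lam i) • P.gradG x i +
      ∑ j, (mu' j - mu j) • P.gradH x j := by
    rw [hw, gradLagrangian_eq hf hg hh, gradLagrangian_eq hf hg hh,
      ← sum_eq_sum_activeIndices (fun i => (lam' i - lam i) • P.gradG x i)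
        (fun i hi => by simp [h.lam_eq_zero hi, h'.lam_eq_zero hi])]
    simp only [sub_smul, Finset.sum_sub_distrib]
    abel
  have hli := Fintype.linearIndependent_iff.1 hlicq.2
    (Sum.elim (fun i => lam' i - lam i) (Sum.elim (fun j => mu' j - mu j) fun k => -w k)) (by
      simp only [Fintype.sum_sum_type, Sum.elim_inl, Sum.elim_inr, neg_smul,
        Finset.sum_neg_distrib]
      rw [← hwz, ← add_assoc, ← hwe, add_neg_cancel])
  constructor
  · ext i
    by_cases hi : i ∈ P.activeIndices x
    · exact sub_eq_zero.1 (hli (Sum.inl ⟨i, hi⟩))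
    · rw [h.lam_eq_zero hi, h'.lam_eq_zero hi]
  · ext j
    exact sub_eq_zero.1 (hli (Sum.inr (Sum.inl j)))

/-! ### The second-order condition. -/

theorem IsSStationary.inner_hessLagrangian_nonneg (hrho : 0 < P.rho) (hf : ContDiff ℝ 2 P.f)
    (hg : ContDiff ℝ 2 P.g) (hh : ContDiff ℝ 2 P.h)
    (hmin : P.IsLocalMinimum x) (hlicq : P.SPLICQ x) {lam : EuclideanSpace ℝ (Fin m)}
    {mu : EuclideanSpace ℝ (Fin p)} (h : P.IsSStationary x lam mu)
    {d : EuclideanSpace ℝ (Fin n)} (hd : d ∈ P.criticalCone x lam) :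
    0 ≤ inner ℝ d (P.hessLagrangian x lam mu d) := by
  obtain ⟨hdpos, hdzero, hdh, hdz⟩ := hd
  have hdg : ∀ i ∈ P.activeIndices x, inner ℝ (P.gradG x i) d ≤ 0 := fun i hi =>
    (h.lam_nonneg i).lt_or_eq.elim (fun hl => (hdpos i hi hl).le) fun hl => hdzero i hi hl.symm
  obtain ⟨z, hz0, hzd, hz⟩ := exists_feasible_curve hrho hg hh hmin hlicq hdg hdh hdz
  have hL := contDiff_lagrangian hf hg hh lam mu
  refine inner_hessian_nonneg_of_curve (L := fun y => P.lagrangian y lam mu)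
    (G := fun y => P.gradLagrangian y lam mu) (x := x) hL.hasGradientAt_gradient
    (hL.differentiable_gradient x).hasFDerivAt hz0 hzd ?_
  filter_upwards [hz] with t ⟨htf, htg, hth, htz⟩
  -- The two vectors have disjoint supports: the gradient lives on `I₀(x)`, where `z t - x`
  -- vanishes.
  have hinner : inner ℝ (P.gradLagrangian x lam mu) (z t - x) = 0 := by
    rw [PiLp.inner_apply]
    refine Finset.sum_eq_zero fun i _ => ?_
    by_cases hi : i ∈ zeroIndices x
    · have h2 : x i = 0 := hi
      simp [htz i hi, h2]
    · simp [h.grad_eq_zero i hi]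
  -- A positive multiplier forces slope zero, and `g i` is affine along the curve, so it stays zero.
  have hlamg : ∀ i, lam i * P.g (z t) i = 0 := by
    intro i
    by_cases hi : i ∈ P.activeIndices x
    · rcases (h.lam_nonneg i).lt_or_eq with hl | hl
      · rw [htg i hi, hdpos i hi hl, mul_zero, mul_zero]
      · rw [← hl, zero_mul]
    · rw [h.lam_eq_zero hi, zero_mul]
  simp only [hinner, lagrangian, hlamg, hth, h.complementarity, h.h_eq_zero]
  simpa using htf

end SparseProblem

theorem mainTheorem7 {n m p : ℕ} (P : SparseProblem n m p) (hrho : 0 < P.rho)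
    (hf : ContDiff ℝ 2 P.f) (hg : ContDiff ℝ 2 P.g) (hh : ContDiff ℝ 2 P.h)
    (x : EuclideanSpace ℝ (Fin n)) (hmin : P.IsLocalMinimum x) (hlicq : P.SPLICQ x) :
    ∃ (lam : EuclideanSpace ℝ (Fin m)) (mu : EuclideanSpace ℝ (Fin p)),
      P.IsSStationary x lam mu ∧
      (∀ (lam' : EuclideanSpace ℝ (Fin m)) (mu' : EuclideanSpace ℝ (Fin p)),
        P.IsSStationary x lam' mu' → lam' = lam ∧ mu' = mu) ∧
      ∀ d ∈ P.criticalCone x lam, 0 ≤ inner ℝ d (P.hessLagrangian x lam mu d) := by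
  obtain ⟨lam, mu, h⟩ := SparseProblem.exists_isSStationary hrho hf hg hh hmin hlicq
  exact ⟨lam, mu, h, fun _ _ h' => h.unique hf hg hh hlicq h',
    fun _ hd => h.inner_hessLagrangian_nonneg hrho hf hg hh hmin hlicq hd⟩
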